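/- All graphs are finite and simple; $\lambda_1(G)\ge\lambda_2(G)\ge\cdots\ge\lambda_n(G)$ denote the eigenvalues, with multiplicity, of the adjacency matrix of a graph $G$ of order $n$; the nullity of $G$ is the multiplicity of $0$ among them. For $k\ge 2$ let $G_k$ be the graph on $\{v_1,\dots,v_{\lceil k/2\rceil}\}\cup\{w_1,\dots,w_{\lfloor k/2\rfloor}\}$ in which the $v_i$ form a clique, the $w_j$ form a clique, and $v_i\sim w_j$ if and only if $i+j\ge\lfloor k/2\rfloor+2$. For positive integers $n_1,\dots,n_k$ let $G_k[K_{n_1},\dots,K_{n_k}]$ be the generalized lexicographic product: the $i$-th vertex of $G_k$ is replaced by a clique $K_{n_i}$, and all edges are put between the cliques that replace adjacent vertices. **Lemma 4.12.** Let $n\ge 15$. (1) For every $4\le k\le 14$ and all positive integers $n_1,\dots,n_k$ with $n_1+\cdots+n_k=n$, the graph $G=G_k[K_{n_1},\dots,K_{n_k}]$ does not satisfy $\lambda_3(G)=\lambda_4(G)=0$. (2) Let $2\le s\le n-3$, and let $G$ be a connected graph of order $n$ with exactly two positive eigenvalues (counted with multiplicity) and nullity $s$. Then $G$ is not reduced $X$-complete.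 That is, there is no vertex $v^*$ of minimum degree in $G$ such that, with $X=N_G(v^*)$ and $Y=V(G)\setminus(X\cup\{v^*\})$: $|Y|\ge 2$, both $G[X]$ and $G[Y]$ are complete graphs, and for all $x,x'\in X$ one of $N_G(x)\cap Y\subseteq N_G(x')\cap Y$ and $N_G(x')\cap Y\subseteq N_G(x)\cap Y$ holds. -/

import Mathlib

namespace TwoPosEig

/-- The eigenvalues of the adjacency matrix of a finite graph `G`, with multiplicity and in
non-increasing order: index `i` (counted from `0`) is `λ_{i+1}(G)`. -/
noncomputable def adjEigenvalues {V : Type*} [Fintype V] (G : SimpleGraph V) :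
    Fin (Fintype.card V) → ℝ := by
  classical exact (G.isHermitian_adjMatrix ℝ).eigenvalues₀

/-- The positive inertia index `p(G)`: the number of positive eigenvalues, with multiplicity. -/
noncomputable def posInertia {V : Type*} [Fintype V] (G : SimpleGraph V) : ℕ :=
  {i | 0 < adjEigenvalues G i}.ncard

/-- The nullity `η(G)`: the multiplicity of the eigenvalue zero. -/
noncomputable def nullity {V : Type*} [Fintype V] (G : SimpleGraph V) : ℕ :=
  {i | adjEigenvalues G i = 0}.ncard

/-- The vertices `v_1, …, v_{⌈k/2⌉}` (left) and `w_1, …, w_{⌊k/2⌋}` (right) of `G_k`,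
both numbered from `0`. -/
abbrev StairVertex (k : ℕ) : Type := Fin ((k + 1) / 2) ⊕ Fin (k / 2)

/-- The graph `G_k`: two disjoint cliques on the `v`'s and on the `w`'s, and `v_i` is adjacent to
the last `i - 1` of the `w`'s; that is, `v_i ∼ w_j` iff `i + j ≥ ⌊k/2⌋ + 2` when numbering from
`1`, and iff `i + j ≥ ⌊k/2⌋` when numbering from `0`. -/
def stairGraph (k : ℕ) : SimpleGraph (StairVertex k) where
  Adj
    | .inl i, .inl i' => i ≠ i'
    | .inr j, .inr j' => j ≠ j'
    | .inl i, .inr j => k / 2 ≤ i.val + j.val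
    | .inr j, .inl i => k / 2 ≤ i.val + j.val
  symm := ⟨by
    rintro (i | j) (i' | j') h
    · exact Ne.symm h
    · exact h
    · exact h
    · exact Ne.symm h⟩
  loopless := ⟨by
    rintro (i | j) h
    · exact h rfl
    · exact h rfl⟩

/-- The generalized lexicographic product of `H` by complete graphs: each vertex `x` is replaced by
a clique on `m x` vertices, and the cliques of adjacent vertices are completely joined. -/
def lexProductComplete {ι : Type*} (H : SimpleGraph ι) (m : ι → ℕ) :
    SimpleGraph (Σ x, Fin (m x)) where
  Adj p q := H.Adj p.1 q.1 ∨ (p.1 = q.1 ∧ p ≠ q)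
  symm := ⟨fun _ _ h => h.imp (fun h => h.symm) (fun h => ⟨h.1.symm, h.2.symm⟩)⟩
  loopless := ⟨fun _ h => h.elim (fun h => h.ne rfl) (fun h => h.2 rfl)⟩

/-- `G ∈ B_k(n)`: up to isomorphism, `G` is `G_k[K_{n_1}, …, K_{n_k}]` with all `n_i ≥ 1` and
`n_1 + ⋯ + n_k = n`. -/
def MemB {V : Type*} (k n : ℕ) (G : SimpleGraph V) : Prop :=
  ∃ m : StairVertex k → ℕ, (∀ x, 1 ≤ m x) ∧ ∑ x, m x = n ∧
    Nonempty (G ≃g lexProductComplete (stairGraph k) m)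

/-- `G ∈ B_k^{00}(n)`: `G ∈ B_k(n)` and `λ_3(G) = λ_4(G) = 0`. -/
def MemB00 {V : Type*} [Fintype V] (k n : ℕ) (G : SimpleGraph V) : Prop :=
  MemB k n G ∧ ∃ h : 4 ≤ Fintype.card V,
    adjEigenvalues G ⟨2, by omega⟩ = 0 ∧ adjEigenvalues G ⟨3, by omega⟩ = 0

/-- `G ∈ CG^s(n)`: a connected graph of order `n` with exactly two positive eigenvalues and
nullity `s`. -/
def MemCG {V : Type*} [Fintype V] (s n : ℕ) (G : SimpleGraph V) : Prop :=
  G.Connected ∧ Fintype.card V = n ∧ posInertia G = 2 ∧ nullity G = s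

/-- The set `Y` of the vertices outside the closed neighbourhood of `v`. -/
def nonNbrs {V : Type*} (G : SimpleGraph V) (v : V) : Set V := {y | y ≠ v ∧ ¬ G.Adj v y}

/-- `G` is `X`-complete, where `v` is a vertex of minimum degree, `X = N(v)` and `Y = V ∖ N[v]`:
both `X` and `Y` induce complete graphs, and `|Y| ≥ 2`. -/
def IsXComplete {V : Type*} (G : SimpleGraph V) (v : V) : Prop :=
  (∀ u, (G.neighborSet v).ncard ≤ (G.neighborSet u).ncard) ∧
    G.IsClique (G.neighborSet v) ∧ G.IsClique (nonNbrs G v) ∧ 2 ≤ (nonNbrs G v).ncard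

/-- `G` is reduced (with respect to `v`): for any two vertices of `X = N(v)`, their
neighbourhoods in `Y = V ∖ N[v]` are comparable under inclusion. -/
def IsReduced {V : Type*} (G : SimpleGraph V) (v : V) : Prop :=
  ∀ x ∈ G.neighborSet v, ∀ x' ∈ G.neighborSet v,
    G.neighborSet x ∩ nonNbrs G v ⊆ G.neighborSet x' ∩ nonNbrs G v ∨
      G.neighborSet x' ∩ nonNbrs G v ⊆ G.neighborSet x ∩ nonNbrs G v

end TwoPosEig

namespace TwoPosEig

/-! ### Words in two letters acting on the plane -/

/-- The action of a letter on a state: `true` sends `(p, q)` to `(p, q - p)` and `false` sends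
`(p, q)` to `(p + q, q)`. -/
def letterStep : Bool → ℝ × ℝ → ℝ × ℝ
  | true, s => (s.1, s.2 - s.1)
  | false, s => (s.1 + s.2, s.2)

/-- The action of a word on a state, letters acting from the left end on. -/
def wordRun (w : List Bool) (s : ℝ × ℝ) : ℝ × ℝ := w.foldl (fun s b => letterStep b s) s

@[simp] lemma wordRun_nil (s : ℝ × ℝ) : wordRun [] s = s := rfl

@[simp] lemma wordRun_cons (b : Bool) (w : List Bool) (s : ℝ × ℝ) :
    wordRun (b :: w) s = wordRun w (letterStep b s) := rfl

@[simp] lemma wordRun_append (u v : List Bool) (s : ℝ × ℝ) :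
    wordRun (u ++ v) s = wordRun v (wordRun u s) := List.foldl_append

/-- The quarter turn of the plane. -/
def quarterTurn (s : ℝ × ℝ) : ℝ × ℝ := (s.2, -s.1)

lemma letterStep_not (b : Bool) (s : ℝ × ℝ) :
    letterStep (!b) (quarterTurn s) = quarterTurn (letterStep b s) := by
  cases b <;> simp [letterStep, quarterTurn] <;> ring

lemma wordRun_map_not (w : List Bool) (s : ℝ × ℝ) :
    wordRun (w.map (!·)) (quarterTurn s) = quarterTurn (wordRun w s) := by
  induction w generalizing s with
  | nil => rfl
  | cons b w ih => rw [List.map_cons, wordRun_cons, letterStep_not, ih, wordRun_cons]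

/-- The word `pqp`, the half twist of the braid monoid on three strands. -/
def halfTwist : List Bool := [true, false, true]

lemma wordRun_halfTwist (s : ℝ × ℝ) : wordRun halfTwist s = quarterTurn s := by
  simp [halfTwist, letterStep, quarterTurn]

/-! ### The quadratic form of a word graph -/

/-- The total weight of the letters `b` in a weighted word. -/
def letterWeight (b : Bool) : List (Bool × ℝ) → ℝ
  | [] => 0
  | (c, y) :: l => (if c = b then y else 0) + letterWeight b l

/-- The quadratic form of the word graph: equal letters are adjacent, and an earlier `false` is
adjacent to a later `true`. -/
def wordForm : List (Bool × ℝ) → ℝ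
  | [] => 0
  | (c, y) :: l => wordForm l +
      2 * y * (letterWeight true l + if c = false then letterWeight false l else 0)

lemma letterWeight_append (b : Bool) (l l' : List (Bool × ℝ)) :
    letterWeight b (l ++ l') = letterWeight b l + letterWeight b l' := by
  induction l with
  | nil => simp [letterWeight]
  | cons a l ih => simp only [List.cons_append, letterWeight, ih]; ring

lemma wordForm_append (l l' : List (Bool × ℝ)) :
    wordForm (l ++ l') = wordForm l + wordForm l' +
      2 * (letterWeight true l * letterWeight true l' + letterWeight false l * letterWeight false l'
        + letterWeight false l * letterWeight true l') := by
  induction l with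
  | nil => simp [letterWeight, wordForm]
  | cons a l ih =>
    obtain ⟨c, y⟩ := a
    cases c <;> simp [letterWeight, wordForm, ih, letterWeight_append] <;> ring

/-- Evaluation at `c` of a word weighted by linear forms in three variables. -/
def evalWeights (c : Fin 3 → ℝ) (l : List (Bool × (Fin 3 → ℝ))) : List (Bool × ℝ) :=
  l.map fun a => (a.1, ∑ i, c i * a.2 i)

lemma evalWeights_append (c : Fin 3 → ℝ) (l l' : List (Bool × (Fin 3 → ℝ))) :
    evalWeights c (l ++ l') = evalWeights c l ++ evalWeights c l' := List.map_append

/-- The form of the word graph of `w` is positive definite on some three-dimensional space. -/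
def HasPosThree (w : List Bool) : Prop :=
  ∃ l : List (Bool × (Fin 3 → ℝ)), l.map Prod.fst = w ∧
    ∀ c, c ≠ 0 → 0 < wordForm (evalWeights c l)

lemma letterWeight_zero (b : Bool) (v : List Bool) :
    letterWeight b (v.map fun b => (b, 0)) = 0 := by
  induction v with
  | nil => rfl
  | cons a v ih => simp [letterWeight, ih]

lemma wordForm_zero (v : List Bool) : wordForm (v.map fun b => (b, 0)) = 0 := by
  induction v with
  | nil => rfl
  | cons a v ih => simp [wordForm, ih]

lemma HasPosThree.append {w : List Bool} (h : HasPosThree w) (v : List Bool) :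
    HasPosThree (w ++ v) := by
  obtain ⟨l, rfl, hl⟩ := h
  refine ⟨l ++ v.map fun b => (b, 0), by simp [Function.comp_def], fun c hc => ?_⟩
  have hv : evalWeights c (v.map fun b => (b, 0)) = v.map fun b => (b, 0) := by
    simp [evalWeights]
  rw [evalWeights_append, hv, wordForm_append, letterWeight_zero, letterWeight_zero, wordForm_zero]
  simpa using hl c hc

/-- Two words that act alike and have interchangeable forms in every context. -/
def WordEquiv (w w' : List Bool) : Prop :=
  w.length = w'.length ∧ (∀ s, wordRun w s = wordRun w' s) ∧
    ∀ u v, HasPosThree (u ++ w ++ v) ↔ HasPosThree (u ++ w' ++ v)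

namespace WordEquiv

lemma refl (w : List Bool) : WordEquiv w w := ⟨rfl, fun _ => rfl, fun _ _ => Iff.rfl⟩

lemma symm {w w' : List Bool} (h : WordEquiv w w') : WordEquiv w' w :=
  ⟨h.1.symm, fun s => (h.2.1 s).symm, fun u v => (h.2.2 u v).symm⟩

lemma trans {w w' w'' : List Bool} (h : WordEquiv w w') (h' : WordEquiv w' w'') :
    WordEquiv w w'' :=
  ⟨h.1.trans h'.1, fun s => (h.2.1 s).trans (h'.2.1 s),
    fun u v => (h.2.2 u v).trans (h'.2.2 u v)⟩

lemma context {w w' : List Bool} (h : WordEquiv w w') (u v : List Bool) :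
    WordEquiv (u ++ w ++ v) (u ++ w' ++ v) := by
  refine ⟨by simp [h.1], fun s => by simp [h.2.1], fun a b => ?_⟩
  simpa using h.2.2 (a ++ u) (v ++ b)

lemma append_left {w w' : List Bool} (h : WordEquiv w w') (u : List Bool) :
    WordEquiv (u ++ w) (u ++ w') := by simpa using h.context u []

lemma append_right {w w' : List Bool} (h : WordEquiv w w') (v : List Bool) :
    WordEquiv (w ++ v) (w' ++ v) := by simpa using h.context [] v

lemma hasPosThree {w w' : List Bool} (h : WordEquiv w w') : HasPosThree w ↔ HasPosThree w' := by
  simpa using h.2.2 [] []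

end WordEquiv

lemma HasPosThree.of_replace {w w' : List Bool} {u v : List Bool}
    (h : ∀ m : List (Bool × (Fin 3 → ℝ)), m.map Prod.fst = w →
      ∃ m' : List (Bool × (Fin 3 → ℝ)), m'.map Prod.fst = w' ∧ ∀ c,
        wordForm (evalWeights c m') = wordForm (evalWeights c m) ∧
        ∀ b, letterWeight b (evalWeights c m') = letterWeight b (evalWeights c m))
    (hw : HasPosThree (u ++ w ++ v)) : HasPosThree (u ++ w' ++ v) := by
  obtain ⟨l, hl, hpos⟩ := hw
  obtain ⟨l₁, l₂, rfl, h₁, rfl⟩ := List.map_eq_append_iff.1 hl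
  obtain ⟨l₀, m, rfl, rfl, hm⟩ := List.map_eq_append_iff.1 h₁
  obtain ⟨m', rfl, hm'⟩ := h m hm
  refine ⟨l₀ ++ m' ++ l₂, by simp, fun c hc => ?_⟩
  convert hpos c hc using 1
  simp only [evalWeights_append, wordForm_append, letterWeight_append, hm']

lemma exists_weights_of_map_fst {α β : Type*} {m : List (α × β)} {a b c : α}
    (h : m.map Prod.fst = [a, b, c]) : ∃ y₁ y₂ y₃, m = [(a, y₁), (b, y₂), (c, y₃)] := by
  match m, h with
  | [(_, y₁), (_, y₂), (_, y₃)], h =>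
    simp only [List.map_cons, List.map_nil, List.cons.injEq, and_true] at h
    obtain ⟨rfl, rfl, rfl⟩ := h
    exact ⟨y₁, y₂, y₃, rfl⟩

lemma wordEquiv_braid : WordEquiv [true, false, true] [false, true, false] := by
  refine ⟨rfl, fun s => ?_, fun u v => ⟨HasPosThree.of_replace ?_, HasPosThree.of_replace ?_⟩⟩
  · simp [letterStep]
  · intro m hm
    obtain ⟨y₁, y₂, y₃, rfl⟩ := exists_weights_of_map_fst hm
    refine ⟨[(false, y₃), (true, y₁ + y₃), (false, y₂ - y₃)], rfl, fun c => ⟨?_, ?_⟩⟩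
    · simp [evalWeights, wordForm, letterWeight, Fin.sum_univ_three]; ring
    · rintro (_ | _) <;> simp [evalWeights, letterWeight, Fin.sum_univ_three] <;> ring
  · intro m hm
    obtain ⟨y₁, y₂, y₃, rfl⟩ := exists_weights_of_map_fst hm
    refine ⟨[(true, y₂ - y₁), (false, y₁ + y₃), (true, y₁)], rfl, fun c => ⟨?_, ?_⟩⟩
    · simp [evalWeights, wordForm, letterWeight, Fin.sum_univ_three]; ring
    · rintro (_ | _) <;> simp [evalWeights, letterWeight, Fin.sum_univ_three] <;> ring

lemma wordEquiv_cons_halfTwist (b : Bool) :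
    WordEquiv (b :: halfTwist) (halfTwist ++ [!b]) := by
  cases b
  · exact (wordEquiv_braid.symm.append_right [true])
  · exact (wordEquiv_braid.append_left [true])

lemma wordEquiv_append_halfTwist (u : List Bool) :
    WordEquiv (u ++ halfTwist) (halfTwist ++ u.map (!·)) := by
  induction u with
  | nil => exact WordEquiv.refl _
  | cons b u ih =>
    refine (ih.append_left [b]).trans ?_
    simpa using (wordEquiv_cons_halfTwist b).append_right (u.map (!·))

/-- The words without a factor `pqp` or `qpq`. -/
def TwistFree (w : List Bool) : Prop :=
  ∀ b, ¬ [b, !b, b] <:+: w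

lemma TwistFree.tail {b : Bool} {w : List Bool} (h : TwistFree (b :: w)) : TwistFree w :=
  fun c hc => h c (hc.trans (List.suffix_cons b w).isInfix)

lemma TwistFree.map_not {w : List Bool} (h : TwistFree w) : TwistFree (w.map (!·)) := by
  intro b hb
  apply h (!b)
  have := hb.map (!·)
  simpa [Function.comp_def] using this

lemma exists_wordEquiv_twistFree (w : List Bool) :
    ∃ r w', TwistFree w' ∧ WordEquiv w ((List.replicate r halfTwist).flatten ++ w') := by
  induction h : w.length using Nat.strong_induction_on generalizing w with
  | _ n ih =>
    by_cases hw : TwistFree w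
    · exact ⟨0, w, hw, WordEquiv.refl _⟩
    · simp only [TwistFree, not_forall, not_not] at hw
      obtain ⟨b, u, v, rfl⟩ := hw
      have h₁ : WordEquiv (u ++ [b, !b, b] ++ v) (u ++ halfTwist ++ v) := by
        cases b
        · exact wordEquiv_braid.symm.context u v
        · exact WordEquiv.refl _
      have h₂ := h₁.trans ((wordEquiv_append_halfTwist u).append_right v)
      obtain ⟨r, w', hw', he⟩ := ih (u.map (!·) ++ v).length (by simp at h ⊢; omega) _ rfl
      refine ⟨r + 1, w', hw', h₂.trans ?_⟩
      simpa [List.replicate_succ] using he.append_left halfTwist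

/-! ### Growth along twist-free words -/

/-- Some coordinate has absolute value at least two. -/
def IsLarge (s : ℝ × ℝ) : Prop := 2 ≤ |s.1| ∨ 2 ≤ |s.2|

lemma isLarge_wordRun (l : List Bool) :
    (∀ s : ℝ × ℝ, TwistFree (true :: l) →
      (s.1 ≤ 0 ∧ -s.1 < s.2 ∧ 2 ≤ s.2 ∨ 0 ≤ s.1 ∧ s.1 < -s.2 ∧ 2 ≤ -s.2) →
        IsLarge (wordRun l s)) ∧
    (∀ s : ℝ × ℝ, TwistFree (false :: l) →
      (0 ≤ s.2 ∧ s.2 < s.1 ∧ 2 ≤ s.1 ∨ s.2 ≤ 0 ∧ -s.2 < -s.1 ∧ 2 ≤ -s.1) →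
        IsLarge (wordRun l s)) := by
  induction h : l.length using Nat.strong_induction_on generalizing l with
  | _ n ih =>
    subst h
    constructor
    · rintro ⟨p, q⟩ hl hs
      have hq : 2 ≤ |q| := by rcases hs with hs | hs <;> simp only [le_abs] <;> simp_all
      match l, hl, ih with
      | [], _, _ => exact Or.inr hq
      | [false], _, _ => exact Or.inr hq
      | true :: l, hl, ih =>
        refine (ih l.length (by simp) l rfl).1 _ hl.tail ?_
        simp only [letterStep]
        rcases hs with hs | hs
        · exact Or.inl ⟨by linarith, by linarith, by linarith⟩
        · exact Or.inr ⟨by linarith, by linarith, by linarith⟩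
      | false :: true :: l, hl, _ => exact (hl true ⟨[], l, rfl⟩).elim
      | false :: false :: l, hl, ih =>
        refine (ih l.length (by simp) l rfl).2 _ hl.tail.tail ?_
        simp only [letterStep]
        rcases hs with hs | hs
        · exact Or.inl ⟨by linarith, by linarith, by linarith⟩
        · exact Or.inr ⟨by linarith, by linarith, by linarith⟩
    · rintro ⟨p, q⟩ hl hs
      have hp : 2 ≤ |p| := by rcases hs with hs | hs <;> simp only [le_abs] <;> simp_all
      match l, hl, ih with
      | [], _, _ => exact Or.inl hp
      | [true], _, _ => exact Or.inl hp
      | false :: l, hl, ih =>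
        refine (ih l.length (by simp) l rfl).2 _ hl.tail ?_
        simp only [letterStep]
        rcases hs with hs | hs
        · exact Or.inl ⟨by linarith, by linarith, by linarith⟩
        · exact Or.inr ⟨by linarith, by linarith, by linarith⟩
      | true :: false :: l, hl, _ => exact (hl false ⟨[], l, rfl⟩).elim
      | true :: true :: l, hl, ih =>
        refine (ih l.length (by simp) l rfl).1 _ hl.tail.tail ?_
        simp only [letterStep]
        rcases hs with hs | hs
        · exact Or.inr ⟨by linarith, by linarith, by linarith⟩
        · exact Or.inl ⟨by linarith, by linarith, by linarith⟩

lemma TwistFree.first_runs (l : List Bool) (hl : TwistFree (true :: l)) :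
    (∃ a, l = List.replicate a true) ∨ (∃ a, l = List.replicate a true ++ [false]) ∨
      IsLarge (wordRun l (0, 1)) := by
  induction l with
  | nil => exact Or.inl ⟨0, rfl⟩
  | cons b l ih =>
    cases b with
    | true =>
      rcases ih hl.tail with ⟨a, rfl⟩ | ⟨a, rfl⟩ | h
      · exact Or.inl ⟨a + 1, rfl⟩
      · exact Or.inr (Or.inl ⟨a + 1, rfl⟩)
      · exact Or.inr (Or.inr (by simpa [letterStep] using h))
    | false =>
      match l, hl with
      | [], _ => exact Or.inr (Or.inl ⟨0, rfl⟩)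
      | true :: l, hl => exact (hl true ⟨[], l, rfl⟩).elim
      | false :: l, hl =>
        refine Or.inr (Or.inr ((isLarge_wordRun l).2 _ hl.tail.tail ?_))
        simp only [letterStep]
        norm_num

lemma wordRun_replicate_true (a : ℕ) (p q : ℝ) :
    wordRun (List.replicate a true) (p, q) = (p, q - a * p) := by
  induction a generalizing q with
  | zero => simp
  | succ a ih =>
    rw [List.replicate_succ, wordRun_cons, letterStep, ih]
    ext
    · rfl
    · push_cast; ring

/-- The four unit vectors on the coordinate axes. -/
def IsAxisUnit (s : ℝ × ℝ) : Prop := s = (1, 0) ∨ s = (0, 1) ∨ s = (-1, 0) ∨ s = (0, -1)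

lemma IsAxisUnit.quarterTurn {s : ℝ × ℝ} (h : IsAxisUnit s) : IsAxisUnit (quarterTurn s) := by
  rcases h with rfl | rfl | rfl | rfl <;> simp [IsAxisUnit, TwoPosEig.quarterTurn]

lemma isLarge_quarterTurn (s : ℝ × ℝ) : IsLarge (quarterTurn s) ↔ IsLarge s := by
  simp [IsLarge, quarterTurn, or_comm]

lemma IsAxisUnit.exists_quarterTurn {s : ℝ × ℝ} (h : IsAxisUnit s) :
    ∃ t, IsAxisUnit t ∧ TwoPosEig.quarterTurn t = s := by
  refine ⟨_, h.quarterTurn.quarterTurn.quarterTurn, ?_⟩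
  ext <;> simp [TwoPosEig.quarterTurn]

lemma TwistFree.length_le_two_of_true {l : List Bool} (hl : TwistFree (true :: l))
    (h : ∀ s, IsAxisUnit s → ¬ IsLarge (wordRun (true :: l) s)) : (true :: l).length ≤ 2 := by
  have h₁ := h (1, 0) (by simp [IsAxisUnit])
  rcases hl.first_runs with ⟨a, rfl⟩ | ⟨a, rfl⟩ | h'
  · by_contra! ha
    apply h₁
    rw [← List.replicate_succ, wordRun_replicate_true]
    right
    simp only [List.length_cons, List.length_replicate] at ha
    have : (2 : ℝ) ≤ a := by exact_mod_cast (by omega : 2 ≤ a)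
    rw [le_abs]; right; push_cast; linarith
  · by_contra! ha
    apply h₁
    rw [← List.cons_append, ← List.replicate_succ, wordRun_append, wordRun_replicate_true]
    right
    simp only [List.length_cons, List.length_append, List.length_replicate, List.length_nil] at ha
    have : (1 : ℝ) ≤ a := by exact_mod_cast (by omega : 1 ≤ a)
    simp only [wordRun_cons, wordRun_nil, letterStep]
    rw [le_abs]; right; push_cast; linarith
  · exact (h (0, 1) (by simp [IsAxisUnit]) (by simpa [letterStep] using h')).elim

lemma TwistFree.length_le_two {w : List Bool} (hw : TwistFree w)
    (h : ∀ s, IsAxisUnit s → ¬ IsLarge (wordRun w s)) : w.length ≤ 2 := by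
  match w, hw, h with
  | [], _, _ => simp
  | true :: l, hw, h => exact hw.length_le_two_of_true h
  | false :: l, hw, h =>
    have := TwistFree.length_le_two_of_true (l := l.map (!·)) (by simpa using hw.map_not) ?_
    · simpa using this
    · intro s hs
      obtain ⟨t, ht, rfl⟩ := hs.exists_quarterTurn
      have := wordRun_map_not (false :: l) t
      simp only [List.map_cons, Bool.not_false] at this
      rw [this, isLarge_quarterTurn]
      exact h t ht

lemma IsAxisUnit.exists_halfTwists (r : ℕ) {s : ℝ × ℝ} (h : IsAxisUnit s) :
    ∃ t, IsAxisUnit t ∧ wordRun (List.replicate r halfTwist).flatten t = s := by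
  induction r generalizing s with
  | zero => exact ⟨s, h, rfl⟩
  | succ r ih =>
    obtain ⟨t, ht, rfl⟩ := ih h
    obtain ⟨t', ht', rfl⟩ := ht.exists_quarterTurn
    refine ⟨t', ht', ?_⟩
    rw [List.replicate_succ, List.flatten_cons, wordRun_append, wordRun_halfTwist]

lemma hasPosThree_halfTwist_five : HasPosThree (List.replicate 5 halfTwist).flatten := by
  refine ⟨[(true, ![0, -1, 0]), (false, 0), (true, ![0, -1, 0]), (true, ![0, -1, 0]),
    (false, ![0, 0, 1]), (true, 0), (true, 0), (false, ![0, 0, 1]), (true, ![0, 0, 1]),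
    (true, ![0, 0, 1]), (false, ![1, 0, 0]), (true, 0), (true, 0), (false, ![1, 0, 0]),
    (true, ![1, 0, 0])], rfl, fun c hc => ?_⟩
  have key : ∀ x y z : ℝ, (x ≠ 0 ∨ y ≠ 0 ∨ z ≠ 0) →
      0 < 6 * (x - y / 2 + 4 * z / 3) ^ 2 + 9 / 2 * (y - 4 / 9 * z) ^ 2 + 4 / 9 * z ^ 2 := by
    intro x y z h
    by_cases hz : z = 0
    · by_cases hy : y = 0
      · have hx : x ≠ 0 := by tauto
        subst hz hy
        have := pow_pos (abs_pos.2 hx) 2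
        rw [sq_abs] at this
        nlinarith
      · subst hz
        have := pow_pos (abs_pos.2 hy) 2
        rw [sq_abs] at this
        nlinarith [sq_nonneg (x - y / 2)]
    · positivity
  have hc' : c 0 ≠ 0 ∨ c 1 ≠ 0 ∨ c 2 ≠ 0 := by
    by_contra! h
    apply hc
    ext i
    fin_cases i
    exacts [h.1, h.2.1, h.2.2]
  convert key (c 0) (c 1) (c 2) hc' using 1
  simp [evalWeights, wordForm, letterWeight, Fin.sum_univ_three]
  ring

/-- A long word that acts as `(p, q) ↦ (q, q - p)` has a form with three positive squares. -/
theorem hasPosThree_of_wordRun {w : List Bool} (hw : 15 ≤ w.length)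
    (h : ∀ s, wordRun w s = (s.2, s.2 - s.1)) : HasPosThree w := by
  obtain ⟨r, w', hw', he⟩ := exists_wordEquiv_twistFree w
  have hlen : w'.length ≤ 2 := by
    refine hw'.length_le_two fun s hs => ?_
    obtain ⟨t, ht, rfl⟩ := hs.exists_halfTwists r
    rw [← wordRun_append, ← he.2.1, h]
    rcases ht with rfl | rfl | rfl | rfl <;> norm_num [IsLarge]
  have hr : 5 ≤ r := by
    have := he.1
    simp [halfTwist] at this
    omega
  rw [he.hasPosThree]
  obtain ⟨k, rfl⟩ := Nat.exists_eq_add_of_le hr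
  rw [List.replicate_add, List.flatten_append, List.append_assoc]
  exact hasPosThree_halfTwist_five.append _

/-! ### Spectral input -/

section Spectral

variable {V : Type*} [Fintype V]

open Classical in
lemma adjEigenvalues_card (G : SimpleGraph V) (p : ℝ → Prop) :
    {i | p (adjEigenvalues G i)}.ncard =
      Fintype.card {v // p ((G.isHermitian_adjMatrix ℝ).eigenvalues v)} := by
  rw [← Nat.card_coe_set_eq]
  refine (Nat.card_congr ((Fintype.equivOfCardEq (Fintype.card_fin _)).subtypeEquiv
    fun i => ?_)).trans Nat.card_eq_fintype_card
  simp only [Set.mem_ofPred_eq, Matrix.IsHermitian.eigenvalues, Equiv.symm_apply_apply]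
  rfl

open Classical in
/-- The spectral decomposition of the quadratic form of the adjacency matrix. -/
lemma dotProduct_adjMatrix_mulVec (G : SimpleGraph V) (x : V → ℝ) :
    x ⬝ᵥ (G.adjMatrix ℝ).mulVec x =
      ∑ v, (G.isHermitian_adjMatrix ℝ).eigenvalues v *
        (((G.isHermitian_adjMatrix ℝ).eigenvectorBasis v).ofLp ⬝ᵥ x) ^ 2 := by
  set hA := G.isHermitian_adjMatrix ℝ
  have hx : x = ∑ v, ((hA.eigenvectorBasis v).ofLp ⬝ᵥ x) • (hA.eigenvectorBasis v).ofLp := by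
    have := congrArg WithLp.ofLp (hA.eigenvectorBasis.sum_repr' (WithLp.toLp 2 x))
    simp only [WithLp.ofLp_sum, WithLp.ofLp_smul] at this
    refine this.symm.trans (Finset.sum_congr rfl fun v _ => ?_)
    simp [EuclideanSpace.inner_eq_star_dotProduct, dotProduct_comm]
  conv_lhs => enter [2]; rw [hx]
  rw [Matrix.mulVec_sum, dotProduct_sum]
  refine Finset.sum_congr rfl fun v _ => ?_
  rw [Matrix.mulVec_smul, hA.mulVec_eigenvectorBasis, dotProduct_smul, dotProduct_smul,
    dotProduct_comm x]
  simp only [smul_eq_mul]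
  ring

open Classical in
lemma exists_dotProduct_nonpos (G : SimpleGraph V) (hG : posInertia G ≤ 2)
    (f : (Fin 3 → ℝ) →ₗ[ℝ] (V → ℝ)) :
    ∃ c, c ≠ 0 ∧ f c ⬝ᵥ (G.adjMatrix ℝ).mulVec (f c) ≤ 0 := by
  set hA := G.isHermitian_adjMatrix ℝ
  rw [posInertia, adjEigenvalues_card G (fun t => 0 < t)] at hG
  let g : (Fin 3 → ℝ) →ₗ[ℝ] ({v // 0 < hA.eigenvalues v} → ℝ) :=
    LinearMap.pi fun v => (dotProductBilin ℝ ℝ (hA.eigenvectorBasis v.1).ofLp).comp f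
  have hg : LinearMap.ker g ≠ ⊥ := by
    apply LinearMap.ker_ne_bot_of_finrank_lt
    simp only [Module.finrank_fintype_fun_eq_card, Fintype.card_fin]
    omega
  obtain ⟨c, hc, hc0⟩ := Submodule.exists_mem_ne_zero_of_ne_bot hg
  refine ⟨c, hc0, ?_⟩
  rw [dotProduct_adjMatrix_mulVec]
  refine Finset.sum_nonpos fun v _ => ?_
  by_cases hv : 0 < hA.eigenvalues v
  · have : (hA.eigenvectorBasis v).ofLp ⬝ᵥ f c = 0 := congrFun (LinearMap.mem_ker.1 hc) ⟨v, hv⟩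
    rw [this]; simp
  · exact mul_nonpos_of_nonpos_of_nonneg (not_lt.1 hv) (sq_nonneg _)

open Classical in
lemma exists_linearIndependent_ker (G : SimpleGraph V) (hG : 2 ≤ nullity G) :
    ∃ x : Fin 2 → V → ℝ, LinearIndependent ℝ x ∧ ∀ i, (G.adjMatrix ℝ).mulVec (x i) = 0 := by
  set hA := G.isHermitian_adjMatrix ℝ
  rw [nullity, adjEigenvalues_card G (fun t => t = 0)] at hG
  obtain ⟨e⟩ := Function.Embedding.nonempty_of_card_le
    (α := Fin 2) (β := {v // hA.eigenvalues v = 0}) (by simpa using hG)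
  refine ⟨fun i => (hA.eigenvectorBasis (e i).1).ofLp, ?_, fun i => ?_⟩
  · have h := hA.eigenvectorBasis.toBasis.linearIndependent.comp (fun i => (e i).1)
      (Subtype.val_injective.comp e.injective)
    have h' := h.map' (WithLp.linearEquiv 2 ℝ (V → ℝ)).toLinearMap (LinearEquiv.ker _)
    simpa [Function.comp_def] using h'
  · rw [hA.mulVec_eigenvectorBasis, (e i).2, zero_smul]

end Spectral

/-! ### Words and functions on `Fin n` -/

lemma letterWeight_ofFn {n : ℕ} (b : Bool) (τ : Fin n → Bool) (y : Fin n → ℝ) :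
    letterWeight b (List.ofFn fun i => (τ i, y i)) = ∑ i, if τ i = b then y i else 0 := by
  induction n with
  | zero => simp [letterWeight]
  | succ n ih => rw [List.ofFn_succ, letterWeight, ih, Fin.sum_univ_succ]

lemma wordForm_ofFn {n : ℕ} (τ : Fin n → Bool) (y : Fin n → ℝ) :
    wordForm (List.ofFn fun i => (τ i, y i)) =
      ∑ i, ∑ j, if i < j ∧ (τ i = τ j ∨ τ j = true) then 2 * (y i * y j) else 0 := by
  induction n with
  | zero => simp [wordForm]
  | succ n ih =>
    rw [List.ofFn_succ, wordForm, ih, letterWeight_ofFn, letterWeight_ofFn, Fin.sum_univ_succ,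
      Fin.sum_univ_succ, add_comm]
    congr 1
    · simp only [lt_self_iff_false, false_and, if_false, Fin.succ_pos, true_and, zero_add]
      have : (if τ 0 = false then ∑ i : Fin n, if τ i.succ = false then y i.succ else 0 else 0) =
          ∑ i : Fin n, if τ 0 = false ∧ τ i.succ = false then y i.succ else 0 := by
        split_ifs with h <;> simp [h]
      rw [this, ← Finset.sum_add_distrib, Finset.mul_sum]
      refine Finset.sum_congr rfl fun i _ => ?_
      cases τ 0 <;> cases τ i.succ <;> simp <;> ring
    · refine Finset.sum_congr rfl fun i _ => ?_
      rw [Fin.sum_univ_succ]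
      simp

/-- A vector satisfies the recursion of the word action from the state `s` on. -/
def IsWordSolution {n : ℕ} (τ : Fin n → Bool) (s : ℝ × ℝ) (y : Fin n → ℝ) : Prop :=
  ∀ i, y i = if τ i = true then s.1 + ∑ j, (if j < i ∧ τ j = false then y j else 0)
    else s.2 - ∑ j, if j < i ∧ τ j = true then y j else 0

lemma IsWordSolution.wordRun_eq {n : ℕ} {τ : Fin n → Bool} {s : ℝ × ℝ} {y : Fin n → ℝ}
    (h : IsWordSolution τ s y) :
    wordRun (List.ofFn τ) s = (s.1 + ∑ j, (if τ j = false then y j else 0),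
      s.2 - ∑ j, if τ j = true then y j else 0) := by
  induction n generalizing s with
  | zero => simp
  | succ n ih =>
    have h0 := h 0
    simp only [Fin.not_lt_zero, false_and, if_false, Finset.sum_const_zero, add_zero,
      sub_zero] at h0
    have hs : IsWordSolution (fun i => τ i.succ) (letterStep (τ 0) s) (fun i => y i.succ) := by
      intro i
      refine (h i.succ).trans ?_
      rw [Fin.sum_univ_succ, Fin.sum_univ_succ]
      simp only [Fin.succ_pos, true_and, Fin.succ_lt_succ_iff]
      cases h₀ : τ 0 <;> cases τ i.succ <;> simp [h₀] at h0 ⊢ <;> simp [letterStep, h0] <;> ring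
    rw [List.ofFn_succ, wordRun_cons, ih hs, Fin.sum_univ_succ, Fin.sum_univ_succ]
    cases h₀ : τ 0 <;> simp [h₀] at h0 ⊢ <;> simp [letterStep, h0] <;> ring

lemma IsWordSolution.eq_zero {n : ℕ} {τ : Fin n → Bool} {y : Fin n → ℝ}
    (h : IsWordSolution τ (0, 0) y) : y = 0 := by
  ext i
  induction i using WellFoundedLT.induction with
  | _ i ih =>
    have h₁ : ∀ b, (∑ j, if j < i ∧ τ j = b then y j else 0) = 0 := fun b =>
      Finset.sum_eq_zero fun j _ => by
        split_ifs with hj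
        exacts [ih j hj.1, rfl]
    rw [h i, h₁, h₁]
    simp

/-! ### Graphs covered by two cliques with nested neighbourhoods -/

section WordGraph

variable {V : Type*} [Fintype V] {n : ℕ}

/-- `e` lists the vertices of `G` so that, with letters `τ`, equal letters are adjacent, an earlier
`false` is adjacent to a later `true`, and an earlier `true` is not adjacent to a later `false`. -/
def IsWordGraph (G : SimpleGraph V) (e : Fin n ≃ V) (τ : Fin n → Bool) : Prop :=
  ∀ i j, i < j → (G.Adj (e i) (e j) ↔ τ i = τ j ∨ τ j = true)

open Classical in
lemma adjMatrix_mulVec_equiv (G : SimpleGraph V) (e : Fin n ≃ V) (x : V → ℝ) (i : Fin n) :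
    (G.adjMatrix ℝ).mulVec x (e i) = ∑ j, if G.Adj (e i) (e j) then x (e j) else 0 := by
  simp only [Matrix.mulVec, dotProduct, SimpleGraph.adjMatrix_apply, ite_mul, one_mul, zero_mul]
  exact (e.sum_comp fun v => if G.Adj (e i) v then x v else 0).symm

open Classical in
lemma IsWordGraph.dotProduct_mulVec {G : SimpleGraph V} {e : Fin n ≃ V} {τ : Fin n → Bool}
    (h : IsWordGraph G e τ) (x : V → ℝ) :
    x ⬝ᵥ (G.adjMatrix ℝ).mulVec x = wordForm (List.ofFn fun i => (τ i, x (e i))) := by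
  have h₁ : x ⬝ᵥ (G.adjMatrix ℝ).mulVec x =
      ∑ i, ∑ j, if G.Adj (e i) (e j) then x (e i) * x (e j) else 0 := by
    rw [dotProduct, ← e.sum_comp]
    simp only [adjMatrix_mulVec_equiv, Finset.mul_sum, mul_ite, mul_zero]
  have h₂ : ∀ i j, (if G.Adj (e i) (e j) then x (e i) * x (e j) else 0) =
      (if i < j ∧ (τ i = τ j ∨ τ j = true) then x (e i) * x (e j) else 0) +
        if j < i ∧ (τ j = τ i ∨ τ i = true) then x (e j) * x (e i) else 0 := by
    intro i j
    rcases lt_trichotomy i j with hij | rfl | hij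
    · simp [h i j hij, hij, hij.not_gt]
    · simp
    · simp [G.adj_comm (e i), h j i hij, hij, hij.not_gt, mul_comm (x (e i))]
  rw [h₁, wordForm_ofFn]
  simp only [h₂, Finset.sum_add_distrib]
  rw [Finset.sum_comm (f := fun i j => if j < i ∧ (τ j = τ i ∨ τ i = true) then _ else _),
    ← Finset.sum_add_distrib]
  refine Finset.sum_congr rfl fun i _ => ?_
  rw [← Finset.sum_add_distrib]
  refine Finset.sum_congr rfl fun j _ => ?_
  split_ifs <;> ring

open Classical in
lemma IsWordGraph.isWordSolution {G : SimpleGraph V} {e : Fin n ≃ V} {τ : Fin n → Bool}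
    (h : IsWordGraph G e τ) {x : V → ℝ} (hx : (G.adjMatrix ℝ).mulVec x = 0) :
    IsWordSolution τ (∑ j, (if τ j = true then x (e j) else 0), ∑ j, x (e j))
      (fun i => x (e i)) := by
  intro i
  have h0 := (adjMatrix_mulVec_equiv G e x i).symm.trans (congrFun hx (e i))
  have hi : x (e i) = ∑ j, ((if j = i then x (e j) else 0) +
      if G.Adj (e i) (e j) then x (e j) else 0) := by
    rw [Finset.sum_add_distrib, h0]; simp
  have hadj : ∀ j, j ≠ i →
      (G.Adj (e i) (e j) ↔ τ i = τ j ∨ if i < j then τ j = true else τ i = true) := by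
    intro j hj
    rcases hj.lt_or_gt with hij | hij
    · rw [G.adj_comm, h j i hij, if_neg hij.not_gt, eq_comm]
    · rw [h i j hij, if_pos hij]
  refine hi.trans ?_
  cases hτ : τ i with
  | true =>
    simp only [if_true, ← Finset.sum_add_distrib]
    refine Finset.sum_congr rfl fun j _ => ?_
    rcases lt_trichotomy j i with hij | rfl | hij
    · cases hj : τ j <;> simp [hadj j hij.ne, hτ, hj, hij, hij.ne, hij.not_gt]
    · simp [hτ]
    · cases hj : τ j <;> simp [hadj j hij.ne', hτ, hj, hij, hij.ne', hij.not_gt]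
  | false =>
    simp only [Bool.false_eq_true, if_false, ← Finset.sum_sub_distrib]
    refine Finset.sum_congr rfl fun j _ => ?_
    rcases lt_trichotomy j i with hij | rfl | hij
    · cases hj : τ j <;> simp [hadj j hij.ne, hτ, hj, hij, hij.ne, hij.not_gt]
    · simp
    · cases hj : τ j <;> simp [hadj j hij.ne', hτ, hj, hij, hij.ne', hij.not_gt]

lemma IsWordGraph.wordRun_eq {G : SimpleGraph V} {e : Fin n ≃ V} {τ : Fin n → Bool}
    (h : IsWordGraph G e τ) (hG : 2 ≤ nullity G) (s : ℝ × ℝ) :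
    wordRun (List.ofFn τ) s = (s.2, s.2 - s.1) := by
  classical
  obtain ⟨x, hx, hker⟩ := exists_linearIndependent_ker G hG
  let L : (V → ℝ) →ₗ[ℝ] ℝ × ℝ :=
    { toFun := fun y => (∑ j, (if τ j = true then y (e j) else 0), ∑ j, y (e j))
      map_add' := fun y z => by
        ext
        · simp only [Pi.add_apply, Prod.fst_add, ← Finset.sum_add_distrib]
          refine Finset.sum_congr rfl fun j _ => ?_
          split_ifs <;> simp
        · simp [Finset.sum_add_distrib]
      map_smul' := fun a y => by ext <;> simp [Finset.mul_sum] }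
  have hmem : ∀ c, (G.adjMatrix ℝ).mulVec (Fintype.linearCombination ℝ x c) = 0 := by
    intro c
    simp [Fintype.linearCombination_apply, Matrix.mulVec_add, Matrix.mulVec_smul, hker]
  let M : (Fin 2 → ℝ) →ₗ[ℝ] ℝ × ℝ := L ∘ₗ Fintype.linearCombination ℝ x
  have hinj : Function.Injective M := by
    rw [← LinearMap.ker_eq_bot, LinearMap.ker_eq_bot']
    intro c hc
    have hs := h.isWordSolution (hmem c)
    rw [show (_, _) = ((0 : ℝ), (0 : ℝ)) from hc] at hs
    have hz : Fintype.linearCombination ℝ x c = 0 := by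
      ext v
      simpa using congrFun hs.eq_zero (e.symm v)
    exact (LinearMap.ker_eq_bot'.1 (LinearMap.ker_eq_bot.2
      (hx.fintypeLinearCombination_injective))) c hz
  have hsurj : Function.Surjective M :=
    (LinearMap.injective_iff_surjective_of_finrank_eq_finrank (by simp)).1 hinj
  obtain ⟨c, rfl⟩ := hsurj s
  have hs := (h.isWordSolution (hmem c)).wordRun_eq
  refine hs.trans ?_
  simp only [M, L, LinearMap.comp_apply, LinearMap.coe_mk, AddHom.coe_mk, ← Finset.sum_add_distrib]
  congr 1
  refine Finset.sum_congr rfl fun j _ => ?_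
  cases τ j <;> simp

lemma IsWordGraph.not_hasPosThree {G : SimpleGraph V} {e : Fin n ≃ V} {τ : Fin n → Bool}
    (h : IsWordGraph G e τ) (hG : posInertia G ≤ 2) : ¬ HasPosThree (List.ofFn τ) := by
  classical
  rintro ⟨l, hl, hpos⟩
  have hlen : l.length = n := by simpa using congrArg List.length hl
  obtain ⟨g, rfl⟩ : ∃ g : Fin n → Bool × (Fin 3 → ℝ), l = List.ofFn g := by
    subst hlen
    exact ⟨l.get, (List.ofFn_get l).symm⟩
  rw [List.map_ofFn] at hl
  have hτ : ∀ i, (g i).1 = τ i := congrFun (List.ofFn_injective hl)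
  let f : (Fin 3 → ℝ) →ₗ[ℝ] (V → ℝ) :=
    LinearMap.pi fun v => Fintype.linearCombination ℝ (g (e.symm v)).2
  obtain ⟨c, hc, hle⟩ := exists_dotProduct_nonpos G hG f
  refine (hpos c hc).not_ge (le_of_eq_of_le ?_ hle)
  rw [h.dotProduct_mulVec, evalWeights, List.map_ofFn]
  congr 2
  ext i : 1
  simp [f, hτ, Fintype.linearCombination_apply]

theorem IsWordGraph.two_lt_posInertia {G : SimpleGraph V} {e : Fin n ≃ V} {τ : Fin n → Bool}
    (h : IsWordGraph G e τ) (hn : 15 ≤ n) (hG : 2 ≤ nullity G) : 2 < posInertia G := by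
  by_contra! hp
  exact h.not_hasPosThree hp (hasPosThree_of_wordRun (by simpa using hn) (h.wordRun_eq hG))

end WordGraph

/-- A graph on at least `15` vertices with nullity at least two has at least three positive
eigenvalues if it is covered by two cliques and the adjacency between the cliques is governed by
a rank function. -/
theorem two_lt_posInertia_of_rank {V : Type*} [Fintype V] (G : SimpleGraph V) (τ : V → Bool)
    (ρ : V → ℕ) (hτ : ∀ u v, u ≠ v → τ u = τ v → G.Adj u v)
    (hρ : ∀ u v, τ u = true → τ v = false → (G.Adj u v ↔ ρ v < ρ u))
    (hne : ∀ u v, τ u = true → τ v = false → ρ u ≠ ρ v)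
    (hV : 15 ≤ Fintype.card V) (hG : 2 ≤ nullity G) : 2 < posInertia G := by
  let f := (Fintype.equivFin V).symm
  let e : Fin (Fintype.card V) ≃ V := (Tuple.sort (ρ ∘ f)).trans f
  have he : Monotone (ρ ∘ e) := Tuple.monotone_sort (ρ ∘ f)
  refine IsWordGraph.two_lt_posInertia (e := e) (τ := τ ∘ e) (fun i j hij => ?_) hV hG
  have hle : ρ (e i) ≤ ρ (e j) := he hij.le
  have hn : e i ≠ e j := fun h => hij.ne (e.injective h)
  simp only [Function.comp_apply]
  cases hi : τ (e i) <;> cases hj : τ (e j)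
  · simp [hτ _ _ hn (hi.trans hj.symm)]
  · simp [G.adj_comm (e i), hρ _ _ hj hi, hle.lt_of_ne (hne _ _ hj hi).symm]
  · simp [hρ _ _ hi hj, hle]
  · simp [hτ _ _ hn (hi.trans hj.symm)]

/-! ### The two families -/

lemma MemB.two_lt_posInertia {V : Type*} [Fintype V] {k n : ℕ} {G : SimpleGraph V}
    (h : MemB k n G) (hn : 15 ≤ n) (hG : 2 ≤ nullity G) : 2 < posInertia G := by
  obtain ⟨m, -, rfl, ⟨φ⟩⟩ := h
  refine two_lt_posInertia_of_rank G (fun v => (φ v).1.isLeft)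
    (fun v => Sum.elim (fun i => 2 * i.val + 1) (fun j => 2 * (k / 2 - j.val)) (φ v).1)
    ?_ ?_ ?_ ?_ hG
  · intro u v huv h
    rw [← φ.map_adj_iff]
    have huv' : φ u ≠ φ v := fun h => huv (φ.injective h)
    generalize φ u = a at *
    generalize φ v = b at *
    by_cases hab : a.1 = b.1
    · exact Or.inr ⟨hab, huv'⟩
    · left
      obtain ⟨i | i, a⟩ := a <;> obtain ⟨j | j, b⟩ := b <;> simp_all [stairGraph]
  · intro u v hu hv
    rw [← φ.map_adj_iff]
    generalize φ u = a at *
    generalize φ v = b at *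
    obtain ⟨i | i, a⟩ := a <;> obtain ⟨j | j, b⟩ := b <;>
      simp [lexProductComplete, stairGraph] at hu hv ⊢
  · intro u v hu hv
    generalize φ u = a at *
    generalize φ v = b at *
    obtain ⟨i | i, a⟩ := a <;> obtain ⟨j | j, b⟩ := b <;> simp at hu hv ⊢
    omega
  · rw [Fintype.card_congr φ.toEquiv]
    simpa using hn

lemma adjEigenvalues_antitone {V : Type*} [Fintype V] (G : SimpleGraph V) :
    Antitone (adjEigenvalues G) := by
  classical exact (G.isHermitian_adjMatrix ℝ).eigenvalues₀_antitone

lemma MemB00.two_le_nullity {V : Type*} [Fintype V] {k n : ℕ} {G : SimpleGraph V}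
    (h : MemB00 k n G) : 2 ≤ nullity G := by
  obtain ⟨-, hV, h₂, h₃⟩ := h
  exact (Set.one_lt_ncard (Set.toFinite _)).2 ⟨_, h₂, _, h₃, by simp⟩

lemma MemB00.posInertia_le_two {V : Type*} [Fintype V] {k n : ℕ} {G : SimpleGraph V}
    (h : MemB00 k n G) : posInertia G ≤ 2 := by
  obtain ⟨-, hV, h₂, -⟩ := h
  have hsub : {i | 0 < adjEigenvalues G i} ⊆ Set.Iio ⟨2, by omega⟩ := by
    intro i hi
    by_contra hlt
    exact (hi.trans_le (adjEigenvalues_antitone G (not_lt.1 hlt))).ne' h₂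
  refine (Set.ncard_le_ncard hsub (Set.toFinite _)).trans_eq ?_
  rw [← Finset.coe_Iio, Set.ncard_coe_finset, Fin.card_Iio]

lemma IsXComplete.two_lt_posInertia {V : Type*} [Fintype V] {G : SimpleGraph V} {v : V}
    (h : IsXComplete G v) (hr : IsReduced G v) (hV : 15 ≤ Fintype.card V) (hG : 2 ≤ nullity G) :
    2 < posInertia G := by
  classical
  obtain ⟨-, hX, hY, -⟩ := h
  let d : V → ℕ := fun x => (G.neighborSet x ∩ nonNbrs G v).ncard
  have hd : ∀ x, d x < Fintype.card V + 1 := fun x =>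
    Nat.lt_succ_of_le ((Set.ncard_le_ncard (Set.subset_univ _)).trans (by simp))
  let S : V → Set ℕ := fun y =>
    {k | k = Fintype.card V + 1 ∨ ∃ x ∈ G.neighborSet v, G.Adj x y ∧ d x = k}
  have hS : ∀ y, sInf (S y) ∈ S y := fun y => Nat.sInf_mem ⟨_, Or.inl rfl⟩
  have hv : d v = 0 := by
    have : G.neighborSet v ∩ nonNbrs G v = ∅ := by
      ext y; simp only [Set.mem_inter_iff, SimpleGraph.mem_neighborSet, nonNbrs]
      simp +contextual
    simp [d, this]
  have hmem : ∀ u, u ∈ nonNbrs G v ↔ ¬ (u = v ∨ G.Adj v u) := fun u => by simp [nonNbrs]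
  refine two_lt_posInertia_of_rank G (fun u => decide (u = v ∨ G.Adj v u))
    (fun u => if u = v ∨ G.Adj v u then 2 * d u + 1 else 2 * sInf (S u)) ?_ ?_ ?_ hV hG
  · intro u u' hne h
    by_cases hu : u = v ∨ G.Adj v u
    · have hu' : u' = v ∨ G.Adj v u' := by simpa [hu] using h
      rcases hu with rfl | hu
      · exact hu'.resolve_left hne.symm
      · rcases hu' with rfl | hu'
        · exact hu.symm
        · exact hX hu hu' hne
    · have hu' : ¬ (u' = v ∨ G.Adj v u') := by simpa [hu] using h
      exact hY ((hmem u).2 hu) ((hmem u').2 hu') hne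
  · intro x y hx hy
    simp only [decide_eq_true_eq, decide_eq_false_iff_not] at hx hy
    rw [if_pos hx, if_neg hy]
    have hyY := (hmem y).2 hy
    have key : G.Adj x y ↔ sInf (S y) ≤ d x := by
      constructor
      · intro hxy
        rcases hx with rfl | hx
        · exact (hy (Or.inr hxy)).elim
        · exact Nat.sInf_le (Or.inr ⟨x, hx, hxy, rfl⟩)
      · intro hle
        rcases hS y with hk | ⟨x', hx', hxy', hk⟩
        · exact absurd (hd x) (by omega)
        · rw [← hk] at hle
          have hpos : y ∈ G.neighborSet x' ∩ nonNbrs G v := ⟨hxy', hyY⟩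
          have hlt : 0 < d x' := (Set.ncard_pos (Set.toFinite _)).2 ⟨y, hpos⟩
          rcases hx with rfl | hx
          · omega
          · rcases hr x hx x' hx' with hs | hs
            · have := Set.eq_of_subset_of_ncard_le hs hle (Set.toFinite _)
              exact (this ▸ hpos).1
            · exact (hs hpos).1
    rw [key]
    omega
  · intro x y hx hy
    simp only [decide_eq_true_eq, decide_eq_false_iff_not] at hx hy
    rw [if_pos hx, if_neg hy]
    omega

end TwoPosEig

theorem lemma4p12 {V : Type*} [Fintype V] (G : SimpleGraph V) (n : ℕ) (hn : 15 ≤ n) :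
    (∀ k : ℕ, 4 ≤ k → k ≤ 14 → ¬ TwoPosEig.MemB00 k n G) ∧
    (∀ s : ℕ, 2 ≤ s → s + 3 ≤ n → TwoPosEig.MemCG s n G →
      ¬ ∃ v : V, TwoPosEig.IsXComplete G v ∧ TwoPosEig.IsReduced G v) := by
  refine ⟨fun k _ _ h => ?_, ?_⟩
  · exact (h.1.two_lt_posInertia hn h.two_le_nullity).not_ge h.posInertia_le_two
  · rintro s hs - ⟨-, rfl, hp, rfl⟩ ⟨v, hv, hr⟩
    exact (hv.two_lt_posInertia hr hn hs).ne' hp
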